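/- **Theorem 4.1.** Let $(M_1,g_1)$ be a Riemannian manifold and $(M_2,g_2,J)$ a Kähler manifold (smooth, finite-dimensional, Hausdorff, without boundary; $J$ is a smooth almost complex structure compatible with $g_2$ and parallel for the Levi-Civita connection), and let $F:M_1\to M_2$ be a slant Riemannian map with slant angle $\theta\neq\frac{\pi}{2}$. That is, $F$ is smooth, each $F_{*p}$ restricts to a linear isometry from $\mathcal H_p=(\ker F_{*p})^\perp$ onto $\mathrm{range}\,F_{*p}$, and for every $p\in M_1$ and every nonzero $x\in\mathcal H_p$ the angle between $JF_*x$ and the space $\mathrm{range}\,F_{*p}$ equals $\theta$. For $w\in \mathrm{range}\,F_{*p}$ let $\phi w$ be the orthogonal projection of $Jw$ to $\mathrm{range}\,F_{*p}$. Let ${}^*F_*$ be the adjoint of $F_*$, let $\nabla^1$ be the Levi-Civita connection of $M_1$, let $\nabla^F$ be the pullback along $F$ of the Levi-Civita connection of $M_2$, and let $(\nabla F_*)(X,Y)=\nabla^F_XF_*Y-F_*(\nabla^1_XY)$ be the second fundamental form of $F$. Let $\Gamma(\mathcal H)$ and $\Gamma(\ker F_*)$ denote the smooth horizontal and vertical vector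 fields on $M_1$. The map $F$ is called *pseudo-horizontally homothetic*, with respect to the structure $\sec\theta\,\phi$ on $\mathrm{range}\,F_*$ (which is $J$ if $\theta=0$), if * $F$ is pseudo-horizontally weakly conformal: $\sec\theta\,\phi$ maps $\mathrm{range}\,F_*$ to itself and has square $-1$ there, and $g_1|_{\mathcal H}$ is Hermitian with respect to $\hat J={}^*F_*\circ(\sec\theta\,\phi)\circ F_*$, i.e. $g_1(\hat JX,\hat JY)=g_1(X,Y)$ for horizontal $X,Y$; and * $(\nabla^1_X\hat J)Y=\nabla^1_X(\hat JY)-\hat J(\nabla^1_XY)=0$ for all $X,Y\in\Gamma(\mathcal H)$. The tensor $\phi$ is called *parallel* if $F_*(\nabla^1_XY')-\phi F_*(\nabla^1_XY)=0$ for all $X,Y,Y'\in\Gamma(\mathcal H)$ with $\phi F_*Y=F_*Y'$. Then $F$ is pseudo-horizontally homothetic if and only if $\phi$ is parallel and $$(\nabla F_*)(X,U)=0\qquad\text{for all } X\in\Gamma(\mathcal H),\ U\in\Gamma(\ker F_*).$$ -/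

import Mathlib

open scoped Manifold ContDiff Bundle
open Bundle

noncomputable section

namespace SlantMap

/-! Throughout, a smooth Riemannian manifold without boundary is a smooth manifold modelled on a
finite-dimensional real normed space, with a smooth inner product on its tangent spaces. -/

instance finiteDimensional_tangentSpace
    {E : Type*} [NormedAddCommGroup E] [NormedSpace ℝ E] [FiniteDimensional ℝ E]
    {M : Type*} [TopologicalSpace M] [ChartedSpace E M] (p : M) :
    FiniteDimensional ℝ (TangentSpace 𝓘(ℝ, E) p) :=
  inferInstanceAs (FiniteDimensional ℝ E)

section OneManifold

variable {E : Type*} [NormedAddCommGroup E] [NormedSpace ℝ E]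
  {M : Type*} [TopologicalSpace M] [ChartedSpace E M] [IsManifold 𝓘(ℝ, E) ∞ M]

/-- `X` is a smooth vector field on `M`, that is `X ∈ Γ(TM)`. -/
def IsSmoothField (X : ∀ p : M, TangentSpace 𝓘(ℝ, E) p) : Prop :=
  ContMDiff 𝓘(ℝ, E) (𝓘(ℝ, E).prod 𝓘(ℝ, E)) ∞ (fun p => (⟨p, X p⟩ : TangentBundle 𝓘(ℝ, E) M))

/-- The vector field near `p` with the value `u` at `p` and constant coefficients in the chart at
`p` (zero outside the domain of that chart). -/
def coordField (p : M) (u : TangentSpace 𝓘(ℝ, E) p) (q : M) : TangentSpace 𝓘(ℝ, E) q :=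
  (trivializationAt E (TangentSpace 𝓘(ℝ, E)) p).symmL ℝ q
    ((trivializationAt E (TangentSpace 𝓘(ℝ, E)) p).continuousLinearMapAt ℝ p u)

variable [RiemannianBundle (fun p : M => TangentSpace 𝓘(ℝ, E) p)]

/-- The Christoffel symbols of the first kind at `p`,
`½ (u⟪W, T⟫ + w⟪U, T⟫ - t⟪U, W⟫)`,
where `U`, `W`, `T` are the vector fields with constant coefficients in the chart at `p` and the
values `u`, `w`, `t` at `p`. (Brackets of such fields vanish, so this is the Koszul
formula for `⟪∇_U W, T⟫` at `p`.) -/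
def christoffelFirst (p : M) (u w t : TangentSpace 𝓘(ℝ, E) p) : ℝ :=
  (1 / 2 : ℝ) *
    (mvfderiv 𝓘(ℝ, E) (fun q => inner ℝ (coordField p w q) (coordField p t q)) p u
    + mvfderiv 𝓘(ℝ, E) (fun q => inner ℝ (coordField p u q) (coordField p t q)) p w
    - mvfderiv 𝓘(ℝ, E) (fun q => inner ℝ (coordField p u q) (coordField p w q)) p t)

variable [FiniteDimensional ℝ E]

/-- The Christoffel symbols of the second kind at `p` in the chart at `p`: the tangent vector
`Γ(u, w)` with `⟪Γ(u, w), t⟫ = christoffelFirst p u w t` for all `t`, written in an orthonormal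
basis. -/
def christoffel (p : M) (u w : TangentSpace 𝓘(ℝ, E) p) : TangentSpace 𝓘(ℝ, E) p :=
  ∑ i, christoffelFirst p u w (stdOrthonormalBasis ℝ (TangentSpace 𝓘(ℝ, E) p) i) •
    stdOrthonormalBasis ℝ (TangentSpace 𝓘(ℝ, E) p) i

end OneManifold

section Along

variable {E₁ : Type*} [NormedAddCommGroup E₁] [NormedSpace ℝ E₁]
  {M₁ : Type*} [TopologicalSpace M₁] [ChartedSpace E₁ M₁]
  {E₂ : Type*} [NormedAddCommGroup E₂] [NormedSpace ℝ E₂] [FiniteDimensional ℝ E₂]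
  {M₂ : Type*} [TopologicalSpace M₂] [ChartedSpace E₂ M₂] [IsManifold 𝓘(ℝ, E₂) ∞ M₂]
  [RiemannianBundle (fun q : M₂ => TangentSpace 𝓘(ℝ, E₂) q)]

/-- The pullback along `F : M₁ → M₂` of the Levi-Civita connection of `M₂`: for a section `V` of
`F⁻¹TM₂` and `v ∈ T_pM₁` this is `(∇^F_v V)(p) = dV(v) + Γ(F_* v, V(p))`, where `dV` is the
derivative of the components of `V` in the chart of `M₂` at `F p`. -/
def pullbackCov (F : M₁ → M₂) (V : ∀ p : M₁, TangentSpace 𝓘(ℝ, E₂) (F p)) (p : M₁)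
    (v : TangentSpace 𝓘(ℝ, E₁) p) : TangentSpace 𝓘(ℝ, E₂) (F p) :=
  (trivializationAt E₂ (TangentSpace 𝓘(ℝ, E₂)) (F p)).symmL ℝ (F p)
      (mvfderiv 𝓘(ℝ, E₁) (fun x =>
        (trivializationAt E₂ (TangentSpace 𝓘(ℝ, E₂)) (F p)).continuousLinearMapAt ℝ (F x) (V x))
        p v)
    + christoffel (F p) (mfderiv 𝓘(ℝ, E₁) 𝓘(ℝ, E₂) F p v) (V p)

/-- The Levi-Civita connection: `leviCivita Y p v = (∇_v Y)(p)`. -/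
def leviCivita (Y : ∀ q : M₂, TangentSpace 𝓘(ℝ, E₂) q) (p : M₂) (v : TangentSpace 𝓘(ℝ, E₂) p) :
    TangentSpace 𝓘(ℝ, E₂) p :=
  pullbackCov (E₁ := E₂) (M₁ := M₂) id Y p v

end Along

/-- `(M, g, J)` is a Kähler manifold: `J` is a smooth tensor field of type `(1,1)` with `J² = -1`,
compatible with the metric and parallel for the Levi-Civita connection. -/
structure IsKaehler
    {E : Type*} [NormedAddCommGroup E] [NormedSpace ℝ E] [FiniteDimensional ℝ E]
    {M : Type*} [TopologicalSpace M] [ChartedSpace E M] [IsManifold 𝓘(ℝ, E) ∞ M]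
    [RiemannianBundle (fun p : M => TangentSpace 𝓘(ℝ, E) p)]
    (J : ∀ p : M, TangentSpace 𝓘(ℝ, E) p →L[ℝ] TangentSpace 𝓘(ℝ, E) p) : Prop where
  smooth : ContMDiff 𝓘(ℝ, E) (𝓘(ℝ, E).prod 𝓘(ℝ, E →L[ℝ] E)) ∞
    (fun p => TotalSpace.mk' (E →L[ℝ] E)
      (E := fun q : M => TangentSpace 𝓘(ℝ, E) q →L[ℝ] TangentSpace 𝓘(ℝ, E) q) p (J p))
  sq : ∀ (p : M) (v : TangentSpace 𝓘(ℝ, E) p), J p (J p v) = -v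
  hermitian : ∀ (p : M) (v w : TangentSpace 𝓘(ℝ, E) p), inner ℝ (J p v) (J p w) = inner ℝ v w
  parallel : ∀ Y : (∀ p : M, TangentSpace 𝓘(ℝ, E) p), IsSmoothField Y →
    ∀ (p : M) (v : TangentSpace 𝓘(ℝ, E) p),
      leviCivita (fun q => J q (Y q)) p v = J p (leviCivita Y p v)

section Maps

variable {E₁ : Type*} [NormedAddCommGroup E₁] [NormedSpace ℝ E₁] [FiniteDimensional ℝ E₁]
  {M₁ : Type*} [TopologicalSpace M₁] [ChartedSpace E₁ M₁] [IsManifold 𝓘(ℝ, E₁) ∞ M₁]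
  [RiemannianBundle (fun p : M₁ => TangentSpace 𝓘(ℝ, E₁) p)]
  {E₂ : Type*} [NormedAddCommGroup E₂] [NormedSpace ℝ E₂] [FiniteDimensional ℝ E₂]
  {M₂ : Type*} [TopologicalSpace M₂] [ChartedSpace E₂ M₂] [IsManifold 𝓘(ℝ, E₂) ∞ M₂]
  [RiemannianBundle (fun q : M₂ => TangentSpace 𝓘(ℝ, E₂) q)]

variable (E₁ E₂) in
/-- The differential `F_{*p}`. -/
def diff (F : M₁ → M₂) (p : M₁) :
    TangentSpace 𝓘(ℝ, E₁) p →ₗ[ℝ] TangentSpace 𝓘(ℝ, E₂) (F p) :=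
  (mfderiv 𝓘(ℝ, E₁) 𝓘(ℝ, E₂) F p).toLinearMap

variable (E₁ E₂) in
/-- The vertical space `ker F_{*p}`. -/
def vert (F : M₁ → M₂) (p : M₁) : Submodule ℝ (TangentSpace 𝓘(ℝ, E₁) p) :=
  LinearMap.ker (diff E₁ E₂ F p)

variable (E₁ E₂) in
/-- The horizontal space `(ker F_{*p})ᗮ`. -/
def horiz (F : M₁ → M₂) (p : M₁) : Submodule ℝ (TangentSpace 𝓘(ℝ, E₁) p) :=
  (vert E₁ E₂ F p)ᗮ

variable (E₁ E₂) in
/-- The space `range F_{*p} ⊆ T_{F p}M₂`. -/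
def rangeAt (F : M₁ → M₂) (p : M₁) : Submodule ℝ (TangentSpace 𝓘(ℝ, E₂) (F p)) :=
  LinearMap.range (diff E₁ E₂ F p)

variable (E₂) in
/-- `X ∈ Γ((ker F_*)ᗮ)`. -/
def IsHorizontalField (F : M₁ → M₂) (X : ∀ p : M₁, TangentSpace 𝓘(ℝ, E₁) p) : Prop :=
  IsSmoothField X ∧ ∀ p, X p ∈ horiz E₁ E₂ F p

variable (E₂) in
/-- `U ∈ Γ(ker F_*)`. -/
def IsVerticalField (F : M₁ → M₂) (U : ∀ p : M₁, TangentSpace 𝓘(ℝ, E₁) p) : Prop :=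
  IsSmoothField U ∧ ∀ p, U p ∈ vert E₁ E₂ F p

variable (E₁ E₂) in
/-- `F` is a Riemannian map: it is smooth and each `F_{*p}` is isometric on `(ker F_{*p})ᗮ`. -/
structure IsRiemannianMap (F : M₁ → M₂) : Prop where
  smooth : ContMDiff 𝓘(ℝ, E₁) 𝓘(ℝ, E₂) ∞ F
  isometric : ∀ p, ∀ x ∈ horiz E₁ E₂ F p, ∀ y ∈ horiz E₁ E₂ F p,
    inner ℝ (diff E₁ E₂ F p x) (diff E₁ E₂ F p y) = inner ℝ x y

/-- The angle between a vector and a subspace: the angle between the vector and its orthogonal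
projection to the subspace (`π / 2` if that projection is zero). -/
def angleToSubspace {W : Type*} [NormedAddCommGroup W] [InnerProductSpace ℝ W]
    (w : W) (S : Submodule ℝ W) [S.HasOrthogonalProjection] : ℝ :=
  InnerProductGeometry.angle w (S.starProjection w)

variable (E₁) in
/-- `F` is a slant Riemannian map with slant angle `θ`: a Riemannian map for which `J F_* x` makes
the angle `θ` with `range F_*`, for every nonzero horizontal vector `x`. -/
structure IsSlantRiemannianMap (F : M₁ → M₂)
    (J : ∀ q : M₂, TangentSpace 𝓘(ℝ, E₂) q →L[ℝ] TangentSpace 𝓘(ℝ, E₂) q) (θ : ℝ) : Prop where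
  isRiemannianMap : IsRiemannianMap E₁ E₂ F
  angle_eq : ∀ p, ∀ x ∈ horiz E₁ E₂ F p, x ≠ 0 →
    angleToSubspace (J (F p) (diff E₁ E₂ F p x)) (rangeAt E₁ E₂ F p) = θ

variable (E₂) in
/-- The second fundamental form `(∇F_*)(X, Y) = ∇^F_X (F_* Y) - F_* (∇_X Y)`. -/
def secondFF (F : M₁ → M₂) (X Y : ∀ p : M₁, TangentSpace 𝓘(ℝ, E₁) p) (p : M₁) :
    TangentSpace 𝓘(ℝ, E₂) (F p) :=
  pullbackCov F (fun x => diff E₁ E₂ F x (Y x)) p (X p) - diff E₁ E₂ F p (leviCivita Y p (X p))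

variable (E₁) in
/-- `φ w` is the component of `J w` in `range F_{*p}`; it is used for `w ∈ range F_{*p}`. -/
def phi (F : M₁ → M₂) (J : ∀ q : M₂, TangentSpace 𝓘(ℝ, E₂) q →L[ℝ] TangentSpace 𝓘(ℝ, E₂) q)
    (p : M₁) : TangentSpace 𝓘(ℝ, E₂) (F p) →ₗ[ℝ] TangentSpace 𝓘(ℝ, E₂) (F p) :=
  (rangeAt E₁ E₂ F p).starProjection.toLinearMap ∘ₗ (J (F p)).toLinearMap

variable (E₁) in
/-- `φ` is parallel: `F_*(∇_X Y') = φ F_*(∇_X Y)` for horizontal `X`, `Y`, `Y'` with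
`φ F_* Y = F_* Y'`. -/
def PhiParallel (F : M₁ → M₂)
    (J : ∀ q : M₂, TangentSpace 𝓘(ℝ, E₂) q →L[ℝ] TangentSpace 𝓘(ℝ, E₂) q) : Prop :=
  ∀ X Y Y' : (∀ p : M₁, TangentSpace 𝓘(ℝ, E₁) p),
    IsHorizontalField E₂ F X → IsHorizontalField E₂ F Y → IsHorizontalField E₂ F Y' →
    (∀ p, phi E₁ F J p (diff E₁ E₂ F p (Y p)) = diff E₁ E₂ F p (Y' p)) →
    ∀ p, diff E₁ E₂ F p (leviCivita Y' p (X p)) - phi E₁ F J p (diff E₁ E₂ F p (leviCivita Y p (X p))) = 0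

variable (E₁) in
/-- Transport to `M₁` of endomorphisms `K p` of `range F_{*p}`: the operator `*F_* ∘ K ∘ F_*`, with
`*F_*` the adjoint of `F_*`. For a Riemannian map it is `F_*⁻¹ ∘ K ∘ F_*` on horizontal vectors,
and zero on vertical ones. -/
def transport (F : M₁ → M₂)
    (K : ∀ p : M₁, TangentSpace 𝓘(ℝ, E₂) (F p) →ₗ[ℝ] TangentSpace 𝓘(ℝ, E₂) (F p)) (p : M₁) :
    TangentSpace 𝓘(ℝ, E₁) p →ₗ[ℝ] TangentSpace 𝓘(ℝ, E₁) p :=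
  LinearMap.adjoint (diff E₁ E₂ F p) ∘ₗ K p ∘ₗ diff E₁ E₂ F p

variable (E₁) in
/-- `F` is pseudo-horizontally weakly conformal for the almost complex structure `K` on
`range F_*`: each `range F_{*p}` is `K`-invariant with `K² = -1` on it, and the metric of
`(ker F_*)ᗮ` is Hermitian for the transported structure. -/
structure IsPHWC (F : M₁ → M₂)
    (K : ∀ p : M₁, TangentSpace 𝓘(ℝ, E₂) (F p) →ₗ[ℝ] TangentSpace 𝓘(ℝ, E₂) (F p)) : Prop where
  invariant : ∀ p, ∀ w ∈ rangeAt E₁ E₂ F p, K p w ∈ rangeAt E₁ E₂ F p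
  sq : ∀ p, ∀ w ∈ rangeAt E₁ E₂ F p, K p (K p w) = -w
  hermitian : ∀ p, ∀ x ∈ horiz E₁ E₂ F p, ∀ y ∈ horiz E₁ E₂ F p,
    inner ℝ (transport E₁ F K p x) (transport E₁ F K p y) = inner ℝ x y

variable (E₁) in
/-- `F` is pseudo-horizontally homothetic for the almost complex structure `K` on `range F_*`: it
is pseudo-horizontally weakly conformal, and the transported structure `Ĵ` on `(ker F_*)ᗮ`
satisfies `(∇_X Ĵ) Y = ∇_X (Ĵ Y) - Ĵ (∇_X Y) = 0` for horizontal `X`, `Y`, with `∇` the Levi-Civita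
connection of `M₁`. -/
structure IsPseudoHorizontallyHomothetic (F : M₁ → M₂)
    (K : ∀ p : M₁, TangentSpace 𝓘(ℝ, E₂) (F p) →ₗ[ℝ] TangentSpace 𝓘(ℝ, E₂) (F p)) : Prop where
  isPHWC : IsPHWC E₁ F K
  parallel : ∀ X Y : (∀ p : M₁, TangentSpace 𝓘(ℝ, E₁) p),
    IsHorizontalField E₂ F X → IsHorizontalField E₂ F Y →
    ∀ p, leviCivita (fun q => transport E₁ F K q (Y q)) p (X p)
      - transport E₁ F K p (leviCivita Y p (X p)) = 0

variable (E₁) in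
/-- The almost complex structure `sec θ · φ` on `range F_*` of a slant Riemannian map with slant
angle `θ ≠ π / 2`. (For `θ = 0` it is the restriction of `J`.) -/
def slantStructure (F : M₁ → M₂)
    (J : ∀ q : M₂, TangentSpace 𝓘(ℝ, E₂) q →L[ℝ] TangentSpace 𝓘(ℝ, E₂) q) (θ : ℝ) (p : M₁) :
    TangentSpace 𝓘(ℝ, E₂) (F p) →ₗ[ℝ] TangentSpace 𝓘(ℝ, E₂) (F p) :=
  (Real.cos θ)⁻¹ • phi E₁ F J p

end Maps

end SlantMap

end

set_option linter.unusedSectionVars false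

/-! On `range F_*` the slant condition says `‖φ w‖ = cos θ ‖w‖`. Polarization and the skewness of
`J` turn this into `φ² = -cos² θ`. When `cos θ ≠ 0`, `sec θ φ` is therefore an orthogonal complex
structure on `range F_*`, weak conformality is automatic (`isPHWC`), and only `∇_X(ĴY) - Ĵ(∇_X Y) =
0` remains.

Since `Ĵ` takes horizontal values, this equation splits. Because `F_* Ĵ = sec θ φ F_*`, its image
under `F_*` is the parallelism of `φ`, up to the factor `sec θ`. Its vertical part is that of
`∇_X(ĴY)`, and `Ĵ² = -1` makes every horizontal `Z` of the form `ĴY`; so it vanishes for all `Y`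
exactly when `∇_X Z` is horizontal for all horizontal `Z`. Metric compatibility (`mvfderiv_inner`)
gives `⟪∇_X U, Z⟫ = -⟪U, ∇_X Z⟫`, while `(∇F_*)(X, U) = -F_*(∇_X U)` for vertical `U`; hence this is
the condition on the second fundamental form (`leviCivita_mem_horiz_iff`).

If `cos θ = 0` although `θ ≠ π / 2`, there is no nonzero horizontal vector, so `F_* = 0` and both
sides hold trivially. -/

namespace SlantMap

/-! ### Smooth vector fields: extension of vectors, and a smoothness test by inner products. -/

section OneManifold

variable {E : Type*} [NormedAddCommGroup E] [NormedSpace ℝ E]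
  {M : Type*} [TopologicalSpace M] [ChartedSpace E M]

theorem contMDiffAt_det {ι : Type*} [Fintype ι] [DecidableEq ι] {A : M → Matrix ι ι ℝ} {p : M}
    (hA : ∀ i j, ContMDiffAt 𝓘(ℝ, E) 𝓘(ℝ, ℝ) ∞ (fun q => A q i j) p) :
    ContMDiffAt 𝓘(ℝ, E) 𝓘(ℝ, ℝ) ∞ (fun q => (A q).det) p := by
  simp only [Matrix.det_apply, Units.smul_def, zsmul_eq_mul]
  refine contMDiffAt_finsetSum fun σ _ => contMDiffAt_const.mul ?_
  exact contMDiffAt_finsetProd fun i _ => hA _ _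

variable [IsManifold 𝓘(ℝ, E) ∞ M]

theorem coordField_self (p : M) (u : TangentSpace 𝓘(ℝ, E) p) : coordField p u p = u :=
  (trivializationAt E (TangentSpace 𝓘(ℝ, E)) p).symmL_continuousLinearMapAt
    (FiberBundle.mem_baseSet_trivializationAt' p) u

theorem contMDiffOn_coordField (p : M) (u : TangentSpace 𝓘(ℝ, E) p) :
    ContMDiffOn 𝓘(ℝ, E) (𝓘(ℝ, E).prod 𝓘(ℝ, E)) ∞
      (fun q => (⟨q, coordField p u q⟩ : TangentBundle 𝓘(ℝ, E) M))
      (trivializationAt E (TangentSpace 𝓘(ℝ, E)) p).baseSet := by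
  intro q hq
  have h := (trivializationAt E (TangentSpace 𝓘(ℝ, E)) p).contMDiffAt_symmL (n := ∞)
    (IB := 𝓘(ℝ, E)) (𝕜 := ℝ) hq
  have := ContMDiffAt.clm_bundle_apply (E₁ := Bundle.Trivial M E) (b := fun q : M => q)
    (v := fun _ => (trivializationAt E (TangentSpace 𝓘(ℝ, E)) p).continuousLinearMapAt ℝ p u)
    h (contMDiffAt_section _ |>.2 contMDiffAt_const)
  exact this.contMDiffWithinAt

variable [FiniteDimensional ℝ E]

/-- A bump function cuts off the constant-coefficient field. This lets conditions quantified over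
global fields be tested on single vectors. -/
theorem exists_isSmoothField_eq [T2Space M] (p : M) (u : TangentSpace 𝓘(ℝ, E) p) :
    ∃ X : ∀ q : M, TangentSpace 𝓘(ℝ, E) q, IsSmoothField X ∧ X p = u := by
  let f : SmoothBumpFunction 𝓘(ℝ, E) p := Classical.arbitrary _
  refine ⟨fun q => f q • coordField p u q, ?_, ?_⟩
  · refine ContMDiffOn.smul_section_of_tsupport (V := fun q : M => TangentSpace 𝓘(ℝ, E) q)
      f.contMDiff.contMDiffOn (trivializationAt E (TangentSpace 𝓘(ℝ, E)) p).open_baseSet ?_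
      (contMDiffOn_coordField p u)
    exact f.tsupport_subset_chartAt_source
  · simp [coordField_self]

section Gram

open Matrix

variable [RiemannianBundle (fun p : M => TangentSpace 𝓘(ℝ, E) p)]
  [IsContMDiffRiemannianBundle 𝓘(ℝ, E) ∞ E (fun p : M => TangentSpace 𝓘(ℝ, E) p)]

/-- A vector field whose inner products with all local smooth fields are smooth is smooth. -/
theorem isSmoothField_of_inner {A : ∀ q : M, TangentSpace 𝓘(ℝ, E) q}
    (hA : ∀ (p : M) (Y : ∀ q : M, TangentSpace 𝓘(ℝ, E) q),
      ContMDiffAt 𝓘(ℝ, E) (𝓘(ℝ, E).prod 𝓘(ℝ, E)) ∞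
        (fun q => (⟨q, Y q⟩ : TangentBundle 𝓘(ℝ, E) M)) p →
      ContMDiffAt 𝓘(ℝ, E) 𝓘(ℝ, ℝ) ∞ (fun q => inner ℝ (A q) (Y q)) p) :
    IsSmoothField A := by
  classical
  intro p
  set e := trivializationAt E (TangentSpace 𝓘(ℝ, E)) p
  have hp : p ∈ e.baseSet := FiberBundle.mem_baseSet_trivializationAt' p
  let b := Module.finBasis ℝ E
  refine (contMDiffAt_iff_localFrameCoeff (e := e) (I := 𝓘(ℝ, E)) b hp).2 fun i => ?_
  let s := e.localFrame b
  have hs : ∀ i, ContMDiffAt 𝓘(ℝ, E) (𝓘(ℝ, E).prod 𝓘(ℝ, E)) ∞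
        (fun q => (⟨q, s i q⟩ : TangentBundle 𝓘(ℝ, E) M)) p :=
    fun i => contMDiffAt_localFrame_of_mem ∞ e b i hp
  -- The coefficients of `A` in the frame `s` solve the linear system with Gram matrix `G` and right
  -- side `l`. Cramer's rule writes each as a quotient of determinants with smooth entries.
  let G : M → Matrix (Fin (Module.finrank ℝ E)) (Fin (Module.finrank ℝ E)) ℝ :=
    fun q => Matrix.of fun j k => inner ℝ (s k q) (s j q)
  let l : M → Fin (Module.finrank ℝ E) → ℝ := fun q j => inner ℝ (A q) (s j q)
  have hG : ∀ j k, ContMDiffAt 𝓘(ℝ, E) 𝓘(ℝ, ℝ) ∞ (fun q => G q j k) p := fun j k =>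
    ContMDiffAt.inner_bundle (F := E) (E := fun q : M => TangentSpace 𝓘(ℝ, E) q) (hs k) (hs j)
  have hGl : ContMDiffAt 𝓘(ℝ, E) 𝓘(ℝ, ℝ) ∞ (fun q => ((G q).updateCol i (l q)).det) p := by
    refine contMDiffAt_det fun j k => ?_
    by_cases hk : k = i
    · subst hk
      simpa using hA p _ (hs j)
    · simpa [Matrix.updateCol_ne hk] using hG j k
  -- A kernel vector of the Gram matrix gives a combination of the frame orthogonal to the whole
  -- frame, hence to itself.
  have hinj : ∀ q ∈ e.baseSet, (G q).det ≠ 0 := by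
    intro q hq h0
    obtain ⟨v, hv, hv0⟩ := Matrix.exists_mulVec_eq_zero_iff.2 h0
    apply hv
    let w : TangentSpace 𝓘(ℝ, E) q := ∑ k, v k • s k q
    have hw : ∀ j, inner ℝ w (s j q) = 0 := fun j => by
      have := congrFun hv0 j
      simpa [G, w, Matrix.mulVec, dotProduct, sum_inner, inner_smul_left, mul_comm] using this
    have hw0 : w = 0 := by
      rw [← inner_self_eq_zero (𝕜 := ℝ)]
      conv_lhs => arg 3; simp only [w]
      simp [inner_sum, inner_smul_right, hw]
    have hb : w = ∑ k, v k • e.basisAt b hq k := by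
      simp [w, s, hq]
    funext k
    exact Fintype.linearIndependent_iff.1 (e.basisAt b hq).linearIndependent v (hb ▸ hw0) k
  have key : ∀ q ∈ e.baseSet, LinearMap.piApply (e.localFrameCoeff 𝓘(ℝ, E) b i) A q =
      ((G q).det)⁻¹ * ((G q).updateCol i (l q)).det := by
    intro q hq
    rw [eq_inv_mul_iff_mul_eq₀ (hinj q hq)]
    let a : Fin (Module.finrank ℝ E) → ℝ := fun k => e.localFrameCoeff 𝓘(ℝ, E) b k q (A q)
    have hl : l q = G q *ᵥ a := by
      funext j
      have : A q = ∑ k, a k • s k q := e.eq_sum_localFrameCoeff_smul hq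
      simp only [l]
      rw [this]
      simp [G, Matrix.mulVec, dotProduct, sum_inner, inner_smul_left, mul_comm]
    rw [← Matrix.cramer_apply, hl, Matrix.cramer_eq_adjugate_mulVec, Matrix.mulVec_mulVec,
      Matrix.adjugate_mul]
    simp [a, Matrix.smul_mulVec]
  refine ContMDiffAt.congr_of_eventuallyEq (ContMDiffAt.mul ?_ hGl)
    (Filter.eventually_of_mem (e.open_baseSet.mem_nhds hp) key)
  exact (contMDiffAt_det hG).inv₀ (hinj p hp)

end Gram

end OneManifold

/-! ### The Levi-Civita connection and its compatibility with the metric. -/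

section OneManifold

variable {E : Type*} [NormedAddCommGroup E] [NormedSpace ℝ E]
  {M : Type*} [TopologicalSpace M] [ChartedSpace E M]

theorem mvfderiv_clm_comp {G G' : Type*} [NormedAddCommGroup G] [NormedSpace ℝ G]
    [NormedAddCommGroup G'] [NormedSpace ℝ G'] (L : G →L[ℝ] G') {w : M → G} {p : M}
    (hw : MDifferentiableAt 𝓘(ℝ, E) 𝓘(ℝ, G) w p) (v : TangentSpace 𝓘(ℝ, E) p) :
    mvfderiv 𝓘(ℝ, E) (fun q => L (w q)) p v = L (mvfderiv 𝓘(ℝ, E) w p v) := by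
  have := (L.hasMFDerivAt (x := w p)).comp p hw.hasMFDerivAt
  exact congrArg (fun T => T v) this.mfderiv

theorem mvfderiv_finsetSum {G ι : Type*} [NormedAddCommGroup G] [NormedSpace ℝ G] (s : Finset ι)
    {f : ι → M → G} {p : M} (hf : ∀ i, MDifferentiableAt 𝓘(ℝ, E) 𝓘(ℝ, G) (f i) p)
    (v : TangentSpace 𝓘(ℝ, E) p) :
    mvfderiv 𝓘(ℝ, E) (fun q => ∑ i ∈ s, f i q) p v = ∑ i ∈ s, mvfderiv 𝓘(ℝ, E) (f i) p v := by
  classical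
  have hs : ∀ s : Finset ι, MDifferentiableAt 𝓘(ℝ, E) 𝓘(ℝ, G) (fun q => ∑ i ∈ s, f i q) p := by
    intro s
    induction s using Finset.induction_on with
    | empty => simpa using mdifferentiableAt_const
    | insert i s hi ih =>
      simp only [Finset.sum_insert hi]
      exact (hf i).add ih
  induction s using Finset.induction_on with
  | empty => simp [mvfderiv_const]
  | insert i s hi ih =>
    simp only [Finset.sum_insert hi]
    rw [mvfderiv_fun_add (hf i) (hs s), ← ih]
    rfl

variable [IsManifold 𝓘(ℝ, E) ∞ M]

theorem coordField_add (p : M) (u w : TangentSpace 𝓘(ℝ, E) p) (q : M) :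
    coordField p (u + w) q = coordField p u q + coordField p w q := by
  simp only [coordField, map_add]

theorem coordField_smul (p : M) (c : ℝ) (u : TangentSpace 𝓘(ℝ, E) p) (q : M) :
    coordField p (c • u) q = c • coordField p u q := by
  simp only [coordField, map_smul]

theorem contMDiffAt_coordField (p : M) (u : TangentSpace 𝓘(ℝ, E) p) :
    ContMDiffAt 𝓘(ℝ, E) (𝓘(ℝ, E).prod 𝓘(ℝ, E)) ∞
      (fun q => (⟨q, coordField p u q⟩ : TangentBundle 𝓘(ℝ, E) M)) p :=
  (contMDiffOn_coordField p u).contMDiffAt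
    ((trivializationAt E (TangentSpace 𝓘(ℝ, E)) p).open_baseSet.mem_nhds
      (FiberBundle.mem_baseSet_trivializationAt' p))

/-- The components of a differentiable field in the chart at `p` are differentiable at `p`. -/
theorem mdifferentiableAt_components {W : ∀ q : M, TangentSpace 𝓘(ℝ, E) q} {p : M}
    (hW : MDifferentiableAt 𝓘(ℝ, E) (𝓘(ℝ, E).prod 𝓘(ℝ, E))
      (fun q => (⟨q, W q⟩ : TangentBundle 𝓘(ℝ, E) M)) p) :
    MDifferentiableAt 𝓘(ℝ, E) 𝓘(ℝ, E) (fun q =>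
      (trivializationAt E (TangentSpace 𝓘(ℝ, E)) p).continuousLinearMapAt ℝ q (W q)) p := by
  set e := trivializationAt E (TangentSpace 𝓘(ℝ, E)) p
  have hp : p ∈ e.baseSet := FiberBundle.mem_baseSet_trivializationAt' p
  refine ((e.mdifferentiableAt_section_iff 𝓘(ℝ, E) W hp).1 hW).congr_of_eventuallyEq ?_
  filter_upwards [e.open_baseSet.mem_nhds hp] with q hq
  exact e.continuousLinearMapAt_apply_of_mem (R := ℝ) hq (W q)

variable [RiemannianBundle (fun p : M => TangentSpace 𝓘(ℝ, E) p)]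
  [IsContMDiffRiemannianBundle 𝓘(ℝ, E) ∞ E (fun p : M => TangentSpace 𝓘(ℝ, E) p)]

theorem mdifferentiableAt_inner {Y Z : ∀ q : M, TangentSpace 𝓘(ℝ, E) q} {p : M}
    (hY : MDifferentiableAt 𝓘(ℝ, E) (𝓘(ℝ, E).prod 𝓘(ℝ, E))
      (fun q => (⟨q, Y q⟩ : TangentBundle 𝓘(ℝ, E) M)) p)
    (hZ : MDifferentiableAt 𝓘(ℝ, E) (𝓘(ℝ, E).prod 𝓘(ℝ, E))
      (fun q => (⟨q, Z q⟩ : TangentBundle 𝓘(ℝ, E) M)) p) :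
    MDifferentiableAt 𝓘(ℝ, E) 𝓘(ℝ, ℝ) (fun q => inner ℝ (Y q) (Z q)) p :=
  MDifferentiableAt.inner_bundle (F := E) (E := fun q : M => TangentSpace 𝓘(ℝ, E) q) hY hZ

theorem mdifferentiableAt_inner_coordField (p : M) (u w : TangentSpace 𝓘(ℝ, E) p) :
    MDifferentiableAt 𝓘(ℝ, E) 𝓘(ℝ, ℝ)
      (fun q => inner ℝ (coordField p u q) (coordField p w q)) p :=
  mdifferentiableAt_inner ((contMDiffAt_coordField p u).mdifferentiableAt (by simp))
    ((contMDiffAt_coordField p w).mdifferentiableAt (by simp))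

/-- The derivative of `⟪u, w⟫` at `p`, for fields with constant coefficients in the chart at `p`. -/
noncomputable def metricDeriv (p : M) (v : TangentSpace 𝓘(ℝ, E) p) :
    TangentSpace 𝓘(ℝ, E) p →ₗ[ℝ] TangentSpace 𝓘(ℝ, E) p →ₗ[ℝ] ℝ :=
  LinearMap.mk₂ ℝ
    (fun u w => mvfderiv 𝓘(ℝ, E) (fun q => inner ℝ (coordField p u q) (coordField p w q)) p v)
    (fun u u' w => by
      simp only [coordField_add, inner_add_left]
      rw [mvfderiv_fun_add (mdifferentiableAt_inner_coordField p u w)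
        (mdifferentiableAt_inner_coordField p u' w)]
      rfl)
    (fun c u w => by
      simp only [coordField_smul, inner_smul_left]
      exact mvfderiv_clm_comp (c • ContinuousLinearMap.id ℝ ℝ)
        (mdifferentiableAt_inner_coordField p u w) v)
    (fun u w w' => by
      simp only [coordField_add, inner_add_right]
      rw [mvfderiv_fun_add (mdifferentiableAt_inner_coordField p u w)
        (mdifferentiableAt_inner_coordField p u w')]
      rfl)
    (fun c u w => by
      simp only [coordField_smul, inner_smul_right]
      exact mvfderiv_clm_comp (c • ContinuousLinearMap.id ℝ ℝ)
        (mdifferentiableAt_inner_coordField p u w) v)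

theorem metricDeriv_apply (p : M) (v u w : TangentSpace 𝓘(ℝ, E) p) :
    metricDeriv p v u w =
      mvfderiv 𝓘(ℝ, E) (fun q => inner ℝ (coordField p u q) (coordField p w q)) p v := rfl

theorem metricDeriv_comm (p : M) (v u w : TangentSpace 𝓘(ℝ, E) p) :
    metricDeriv p v u w = metricDeriv p v w u := by
  simp only [metricDeriv_apply, real_inner_comm]

variable [FiniteDimensional ℝ E]

/-- The right side is linear in `t`, its last term because a derivative is linear in the direction.
It is therefore determined by its values on the orthonormal basis used to define `christoffel`. -/
theorem inner_christoffel (p : M) (u w t : TangentSpace 𝓘(ℝ, E) p) :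
    inner ℝ (christoffel p u w) t = (1 / 2 : ℝ) *
      (metricDeriv p u w t + metricDeriv p w u t - metricDeriv p t u w) := by
  let T := TangentSpace 𝓘(ℝ, E) p
  let D : T →ₗ[ℝ] ℝ :=
    { toFun := fun t => metricDeriv p t u w
      map_add' := fun a b => map_add (mvfderiv 𝓘(ℝ, E) _ p) a b
      map_smul' := fun c a => map_smul (mvfderiv 𝓘(ℝ, E) _ p) c a }
  let L : T →ₗ[ℝ] ℝ := (1 / 2 : ℝ) • (metricDeriv p u w + metricDeriv p w u - D)
  have hL : ∀ t, christoffelFirst p u w t = L t := fun t => rfl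
  change _ = L t
  conv_rhs => rw [← (stdOrthonormalBasis ℝ T).sum_repr' t]
  simp only [christoffel, sum_inner, inner_smul_left, hL, map_sum, map_smul, smul_eq_mul]
  exact Finset.sum_congr rfl fun i _ => mul_comm _ _

theorem christoffel_zero_right (p : M) (u : TangentSpace 𝓘(ℝ, E) p) : christoffel p u 0 = 0 := by
  have h : ∀ t, inner ℝ (christoffel p u 0) t = 0 := fun t => by
    have h0 : metricDeriv p (0 : TangentSpace 𝓘(ℝ, E) p) u t = 0 := by
      rw [metricDeriv_apply]; exact map_zero _
    rw [inner_christoffel, h0]; simp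
  exact inner_self_eq_zero.1 (h _)

theorem christoffel_smul_right (p : M) (u : TangentSpace 𝓘(ℝ, E) p) (c : ℝ)
    (w : TangentSpace 𝓘(ℝ, E) p) : christoffel p u (c • w) = c • christoffel p u w := by
  refine ext_inner_right ℝ fun t => ?_
  have h0 : metricDeriv p (c • w) u t = c * metricDeriv p w u t := by
    simp only [metricDeriv_apply]; exact map_smul _ _ _
  rw [inner_smul_left, inner_christoffel, inner_christoffel, h0]
  simp
  ring

/-- In the two Koszul expressions the derivatives in the directions `u` and `w` cancel, and the two
halves of the derivative along `v` add up. This is metric compatibility for constant-coefficient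
fields. -/
theorem inner_christoffel_add (p : M) (v u w : TangentSpace 𝓘(ℝ, E) p) :
    inner ℝ (christoffel p v u) w + inner ℝ u (christoffel p v w) = metricDeriv p v u w := by
  rw [real_inner_comm, real_inner_comm (christoffel p v w), real_inner_comm,
    inner_christoffel, inner_christoffel, metricDeriv_comm p v w u]
  ring

theorem leviCivita_eq (Y : ∀ q : M, TangentSpace 𝓘(ℝ, E) q) (p : M)
    (v : TangentSpace 𝓘(ℝ, E) p) :
    leviCivita Y p v = (trivializationAt E (TangentSpace 𝓘(ℝ, E)) p).symmL ℝ p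
      (mvfderiv 𝓘(ℝ, E) (fun q =>
        (trivializationAt E (TangentSpace 𝓘(ℝ, E)) p).continuousLinearMapAt ℝ q (Y q)) p v)
      + christoffel p v (Y p) := by
  unfold leviCivita pullbackCov
  rw [mfderiv_id]
  rfl

/-- Where `W` vanishes, the product rule leaves only the derivatives of its components: those of the
metric and of `Z` are multiplied by zero, and so is the Christoffel term. -/
theorem mvfderiv_inner_of_eq_zero {W Z : ∀ q : M, TangentSpace 𝓘(ℝ, E) q} {p : M}
    (hW : MDifferentiableAt 𝓘(ℝ, E) (𝓘(ℝ, E).prod 𝓘(ℝ, E))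
      (fun q => (⟨q, W q⟩ : TangentBundle 𝓘(ℝ, E) M)) p)
    (hZ : MDifferentiableAt 𝓘(ℝ, E) (𝓘(ℝ, E).prod 𝓘(ℝ, E))
      (fun q => (⟨q, Z q⟩ : TangentBundle 𝓘(ℝ, E) M)) p)
    (hp0 : W p = 0) (v : TangentSpace 𝓘(ℝ, E) p) :
    mvfderiv 𝓘(ℝ, E) (fun q => inner ℝ (W q) (Z q)) p v = inner ℝ (leviCivita W p v) (Z p) := by
  rw [leviCivita_eq, hp0, christoffel_zero_right, add_zero]
  set e := trivializationAt E (TangentSpace 𝓘(ℝ, E)) p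
  have hp : p ∈ e.baseSet := FiberBundle.mem_baseSet_trivializationAt' p
  let b := Module.finBasis ℝ E
  let c : Fin (Module.finrank ℝ E) → E →L[ℝ] ℝ := fun i => (b.coord i).toContinuousLinearMap
  let w : M → E := fun q => e.continuousLinearMapAt ℝ q (W q)
  have hw : MDifferentiableAt 𝓘(ℝ, E) 𝓘(ℝ, E) w p := mdifferentiableAt_components hW
  let s : Fin (Module.finrank ℝ E) → ∀ q : M, TangentSpace 𝓘(ℝ, E) q :=
    fun i => coordField p (e.symmL ℝ p (b i))
  have hs : ∀ i, ∀ q, s i q = e.symmL ℝ q (b i) := fun i q => by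
    simp only [s, coordField]
    rw [e.continuousLinearMapAt_symmL hp]
  have hsZ : ∀ i, MDifferentiableAt 𝓘(ℝ, E) 𝓘(ℝ, ℝ) (fun q => inner ℝ (s i q) (Z q)) p := fun i =>
    mdifferentiableAt_inner ((contMDiffAt_coordField p _).mdifferentiableAt (by simp)) hZ
  have hc : ∀ i, MDifferentiableAt 𝓘(ℝ, E) 𝓘(ℝ, ℝ) (fun q => c i (w q)) p := fun i =>
    (c i).mdifferentiableAt.comp p hw
  have hsum : ∀ (q : M) (a : E), e.symmL ℝ q a = ∑ i, c i a • s i q := fun q a => by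
    conv_lhs => rw [← b.sum_repr a, map_sum]
    exact Finset.sum_congr rfl fun i _ => by rw [map_smul, hs]; rfl
  have heq : (fun q => inner ℝ (W q) (Z q)) =ᶠ[nhds p]
      fun q => ∑ i, c i (w q) * inner ℝ (s i q) (Z q) := by
    filter_upwards [e.open_baseSet.mem_nhds hp] with q hq
    have : W q = e.symmL ℝ q (w q) := (e.symmL_continuousLinearMapAt hq (W q)).symm
    rw [this, hsum]
    simp [sum_inner, inner_smul_left]
  have hw0 : w p = 0 := by simp only [w, hp0, map_zero]
  have h1 : mvfderiv 𝓘(ℝ, E) (fun q => inner ℝ (W q) (Z q)) p v =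
      mvfderiv 𝓘(ℝ, E) (fun q => ∑ i, c i (w q) * inner ℝ (s i q) (Z q)) p v :=
    DFunLike.congr_fun heq.mfderiv_eq v
  rw [h1, mvfderiv_finsetSum (f := fun i q => c i (w q) * inner ℝ (s i q) (Z q)) _
    fun i => (hc i).mul (hsZ i), hsum, sum_inner]
  refine Finset.sum_congr rfl fun i _ => ?_
  rw [mvfderiv_fun_mul (hc i) (hsZ i), inner_smul_left]
  simp only [hw0, map_zero, zero_smul, zero_add]
  change inner ℝ (s i p) (Z p) * mvfderiv 𝓘(ℝ, E) (fun q => c i (w q)) p v = _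
  rw [mvfderiv_clm_comp (c i) hw, mul_comm]
  rfl

theorem leviCivita_sub_coordField {Y : ∀ q : M, TangentSpace 𝓘(ℝ, E) q} {p : M}
    (hY : MDifferentiableAt 𝓘(ℝ, E) (𝓘(ℝ, E).prod 𝓘(ℝ, E))
      (fun q => (⟨q, Y q⟩ : TangentBundle 𝓘(ℝ, E) M)) p)
    (v : TangentSpace 𝓘(ℝ, E) p) :
    leviCivita (fun q => Y q - coordField p (Y p) q) p v =
      leviCivita Y p v - christoffel p v (Y p) := by
  rw [leviCivita_eq, leviCivita_eq, coordField_self, sub_self, christoffel_zero_right, add_zero,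
    add_sub_cancel_right]
  congr 1
  set e := trivializationAt E (TangentSpace 𝓘(ℝ, E)) p
  have hp : p ∈ e.baseSet := FiberBundle.mem_baseSet_trivializationAt' p
  have heq : (fun q => e.continuousLinearMapAt ℝ q (Y q - coordField p (Y p) q)) =ᶠ[nhds p]
      fun q => e.continuousLinearMapAt ℝ q (Y q) - e.continuousLinearMapAt ℝ p (Y p) := by
    filter_upwards [e.open_baseSet.mem_nhds hp] with q hq
    rw [map_sub]
    congr 1
    exact e.continuousLinearMapAt_symmL hq _
  have h1 : mvfderiv 𝓘(ℝ, E) (fun q => e.continuousLinearMapAt ℝ q (Y q - coordField p (Y p) q)) p v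
      = mvfderiv 𝓘(ℝ, E) (fun q => e.continuousLinearMapAt ℝ q (Y q) -
        e.continuousLinearMapAt ℝ p (Y p)) p v :=
    DFunLike.congr_fun heq.mfderiv_eq v
  rw [h1, mvfderiv_fun_sub (mdifferentiableAt_components hY) mdifferentiableAt_const,
    mvfderiv_const, sub_zero]

/-- The connection `leviCivita` is compatible with the metric. -/
theorem mvfderiv_inner {Y Z : ∀ q : M, TangentSpace 𝓘(ℝ, E) q} {p : M}
    (hY : MDifferentiableAt 𝓘(ℝ, E) (𝓘(ℝ, E).prod 𝓘(ℝ, E))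
      (fun q => (⟨q, Y q⟩ : TangentBundle 𝓘(ℝ, E) M)) p)
    (hZ : MDifferentiableAt 𝓘(ℝ, E) (𝓘(ℝ, E).prod 𝓘(ℝ, E))
      (fun q => (⟨q, Z q⟩ : TangentBundle 𝓘(ℝ, E) M)) p)
    (v : TangentSpace 𝓘(ℝ, E) p) :
    mvfderiv 𝓘(ℝ, E) (fun q => inner ℝ (Y q) (Z q)) p v =
      inner ℝ (leviCivita Y p v) (Z p) + inner ℝ (Y p) (leviCivita Z p v) := by
  have hc : ∀ u : TangentSpace 𝓘(ℝ, E) p, MDifferentiableAt 𝓘(ℝ, E) (𝓘(ℝ, E).prod 𝓘(ℝ, E))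
      (fun q => (⟨q, coordField p u q⟩ : TangentBundle 𝓘(ℝ, E) M)) p := fun u =>
    (contMDiffAt_coordField p u).mdifferentiableAt (by simp)
  have hYc : MDifferentiableAt 𝓘(ℝ, E) (𝓘(ℝ, E).prod 𝓘(ℝ, E))
      (fun q => (⟨q, Y q - coordField p (Y p) q⟩ : TangentBundle 𝓘(ℝ, E) M)) p :=
    mdifferentiableAt_sub_section hY (hc _)
  have hZc : MDifferentiableAt 𝓘(ℝ, E) (𝓘(ℝ, E).prod 𝓘(ℝ, E))
      (fun q => (⟨q, Z q - coordField p (Z p) q⟩ : TangentBundle 𝓘(ℝ, E) M)) p :=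
    mdifferentiableAt_sub_section hZ (hc _)
  have h1 := mvfderiv_inner_of_eq_zero hYc hZ (by rw [coordField_self, sub_self]) v
  have h2 := mvfderiv_inner_of_eq_zero hZc (hc (Y p)) (by rw [coordField_self, sub_self]) v
  -- With `Y₀`, `Z₀` the constant-coefficient fields with the values of `Y`, `Z` at `p`, the first
  -- two summands have a factor vanishing at `p`, and the third involves only derivatives of the
  -- metric.
  have hsplit : (fun q => inner ℝ (Y q) (Z q)) = fun q =>
      (inner ℝ (Y q - coordField p (Y p) q) (Z q) +
        inner ℝ (Z q - coordField p (Z p) q) (coordField p (Y p) q)) +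
      inner ℝ (coordField p (Y p) q) (coordField p (Z p) q) := by
    funext q
    rw [inner_sub_left, inner_sub_left, real_inner_comm (coordField p (Y p) q) (Z q),
      real_inner_comm (coordField p (Y p) q) (coordField p (Z p) q)]
    ring
  have hd := (mdifferentiableAt_inner hYc hZ).add (mdifferentiableAt_inner hZc (hc (Y p)))
  have ha := mvfderiv_fun_add hd (mdifferentiableAt_inner_coordField p (Y p) (Z p))
  simp only [Pi.add_apply] at ha
  rw [hsplit, ha, mvfderiv_add (mdifferentiableAt_inner hYc hZ) (mdifferentiableAt_inner hZc (hc _))]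
  change mvfderiv 𝓘(ℝ, E) _ p v + mvfderiv 𝓘(ℝ, E) _ p v + metricDeriv p v (Y p) (Z p) = _
  rw [h1, h2, ← inner_christoffel_add, coordField_self, leviCivita_sub_coordField hY,
    leviCivita_sub_coordField hZ, inner_sub_left, inner_sub_left,
    real_inner_comm (Y p) (leviCivita Z p v), real_inner_comm (Y p) (christoffel p v (Z p))]
  ring

theorem leviCivita_smul (c : ℝ) {Y : ∀ q : M, TangentSpace 𝓘(ℝ, E) q} {p : M}
    (hY : MDifferentiableAt 𝓘(ℝ, E) (𝓘(ℝ, E).prod 𝓘(ℝ, E))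
      (fun q => (⟨q, Y q⟩ : TangentBundle 𝓘(ℝ, E) M)) p)
    (v : TangentSpace 𝓘(ℝ, E) p) :
    leviCivita (fun q => c • Y q) p v = c • leviCivita Y p v := by
  simp only [leviCivita_eq, christoffel_smul_right, map_smul, smul_add]
  congr 1
  rw [← map_smul]
  congr 1
  exact mvfderiv_clm_comp (c • ContinuousLinearMap.id ℝ E) (mdifferentiableAt_components hY) v

end OneManifold

/-! ### Pointwise linear algebra of slant Riemannian maps. -/

section Maps

variable {E₁ : Type*} [NormedAddCommGroup E₁] [NormedSpace ℝ E₁] [FiniteDimensional ℝ E₁]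
  {M₁ : Type*} [TopologicalSpace M₁] [ChartedSpace E₁ M₁] [IsManifold 𝓘(ℝ, E₁) ∞ M₁]
  [RiemannianBundle (fun p : M₁ => TangentSpace 𝓘(ℝ, E₁) p)]
  {E₂ : Type*} [NormedAddCommGroup E₂] [NormedSpace ℝ E₂] [FiniteDimensional ℝ E₂]
  {M₂ : Type*} [TopologicalSpace M₂] [ChartedSpace E₂ M₂] [IsManifold 𝓘(ℝ, E₂) ∞ M₂]
  [RiemannianBundle (fun q : M₂ => TangentSpace 𝓘(ℝ, E₂) q)]
  {F : M₁ → M₂} {J : ∀ q : M₂, TangentSpace 𝓘(ℝ, E₂) q →L[ℝ] TangentSpace 𝓘(ℝ, E₂) q} {θ : ℝ}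

theorem adjoint_diff_mem_horiz (F : M₁ → M₂) (p : M₁) (w : TangentSpace 𝓘(ℝ, E₂) (F p)) :
    LinearMap.adjoint (diff E₁ E₂ F p) w ∈ horiz E₁ E₂ F p := by
  rw [horiz, Submodule.mem_orthogonal']
  intro u hu
  rw [LinearMap.adjoint_inner_left, show diff E₁ E₂ F p u = 0 from hu, inner_zero_right]

theorem exists_horiz_diff_eq (F : M₁ → M₂) (p : M₁) {w : TangentSpace 𝓘(ℝ, E₂) (F p)}
    (hw : w ∈ rangeAt E₁ E₂ F p) : ∃ x ∈ horiz E₁ E₂ F p, diff E₁ E₂ F p x = w := by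
  obtain ⟨z, rfl⟩ := hw
  obtain ⟨u, hu, x, hx, rfl⟩ := (vert E₁ E₂ F p).exists_add_mem_mem_orthogonal z
  exact ⟨x, hx, by rw [map_add, show diff E₁ E₂ F p u = 0 from hu, zero_add]⟩

theorem eq_of_forall_inner_eq {W : Type*} [NormedAddCommGroup W] [InnerProductSpace ℝ W]
    {S : Submodule ℝ W} {a b : W} (ha : a ∈ S) (hb : b ∈ S)
    (h : ∀ c ∈ S, inner ℝ a c = inner ℝ b c) : a = b := by
  rw [← sub_eq_zero, ← inner_self_eq_zero (𝕜 := ℝ), inner_sub_left, sub_eq_zero]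
  exact h _ (S.sub_mem ha hb)

/-- Both sides are horizontal and, `F_*` being isometric there, have the same inner products with
horizontal vectors. So `*F_*` inverts `F_*` on the horizontal space. -/
theorem IsRiemannianMap.adjoint_diff_apply (hF : IsRiemannianMap E₁ E₂ F) {p : M₁}
    {x : TangentSpace 𝓘(ℝ, E₁) p} (hx : x ∈ horiz E₁ E₂ F p) :
    LinearMap.adjoint (diff E₁ E₂ F p) (diff E₁ E₂ F p x) = x :=
  eq_of_forall_inner_eq (adjoint_diff_mem_horiz F p _) hx fun y hy => by
    rw [LinearMap.adjoint_inner_left, hF.isometric p x hx y hy]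

theorem IsRiemannianMap.diff_adjoint_apply (hF : IsRiemannianMap E₁ E₂ F) {p : M₁}
    {w : TangentSpace 𝓘(ℝ, E₂) (F p)} (hw : w ∈ rangeAt E₁ E₂ F p) :
    diff E₁ E₂ F p (LinearMap.adjoint (diff E₁ E₂ F p) w) = w := by
  obtain ⟨x, hx, rfl⟩ := exists_horiz_diff_eq F p hw
  rw [hF.adjoint_diff_apply hx]

theorem transport_mem_horiz
    (K : ∀ p : M₁, TangentSpace 𝓘(ℝ, E₂) (F p) →ₗ[ℝ] TangentSpace 𝓘(ℝ, E₂) (F p)) (p : M₁)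
    (x : TangentSpace 𝓘(ℝ, E₁) p) : transport E₁ F K p x ∈ horiz E₁ E₂ F p :=
  adjoint_diff_mem_horiz F p _

theorem phi_mem_rangeAt (p : M₁) (w : TangentSpace 𝓘(ℝ, E₂) (F p)) :
    phi E₁ F J p w ∈ rangeAt E₁ E₂ F p :=
  Submodule.starProjection_apply_mem _ _

theorem slantStructure_apply (p : M₁) (w : TangentSpace 𝓘(ℝ, E₂) (F p)) :
    slantStructure E₁ F J θ p w = (Real.cos θ)⁻¹ • phi E₁ F J p w := rfl

theorem slantStructure_mem_rangeAt (p : M₁) (w : TangentSpace 𝓘(ℝ, E₂) (F p)) :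
    slantStructure E₁ F J θ p w ∈ rangeAt E₁ E₂ F p :=
  Submodule.smul_mem _ _ (phi_mem_rangeAt p w)

theorem inner_phi_left (p : M₁) (v : TangentSpace 𝓘(ℝ, E₂) (F p))
    {w : TangentSpace 𝓘(ℝ, E₂) (F p)} (hw : w ∈ rangeAt E₁ E₂ F p) :
    inner ℝ (phi E₁ F J p v) w = inner ℝ (J (F p) v) w := by
  change inner ℝ ((rangeAt E₁ E₂ F p).starProjection (J (F p) v)) w = _
  rw [Submodule.inner_starProjection_left_eq_right, Submodule.starProjection_eq_self_iff.2 hw]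

/-- The adjoint kills the part of `J w` orthogonal to `range F_*`. Smoothness of `Ĵ` thus reduces to
that of `J`, with no need to treat the projection to `range F_*` as a smooth family. -/
theorem adjoint_phi (p : M₁) (w : TangentSpace 𝓘(ℝ, E₂) (F p)) :
    LinearMap.adjoint (diff E₁ E₂ F p) (phi E₁ F J p w) =
      LinearMap.adjoint (diff E₁ E₂ F p) (J (F p) w) :=
  ext_inner_right ℝ fun x => by
    rw [LinearMap.adjoint_inner_left, LinearMap.adjoint_inner_left]
    exact inner_phi_left p w ⟨x, rfl⟩

theorem IsKaehler.inner_skew (hJ : IsKaehler J) (q : M₂) (v w : TangentSpace 𝓘(ℝ, E₂) q) :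
    inner ℝ (J q v) w = -inner ℝ v (J q w) := by
  have := hJ.hermitian q v (J q w)
  rw [hJ.sq, inner_neg_right] at this
  linarith

/-- With `P` the projection, `⟪v, P v⟫ = ‖P v‖²`, and one factor `‖P v‖` cancels: `P v = 0` would
make the angle `π / 2` by convention. -/
theorem starProjection_norm_of_angle {W : Type*} [NormedAddCommGroup W] [InnerProductSpace ℝ W]
    {v : W} {S : Submodule ℝ W} [S.HasOrthogonalProjection] {θ : ℝ}
    (h : angleToSubspace v S = θ) (hθ : θ ≠ Real.pi / 2) :
    ‖S.starProjection v‖ = Real.cos θ * ‖v‖ := by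
  have h0 : S.starProjection v ≠ 0 := by
    intro h0
    rw [angleToSubspace, h0, InnerProductGeometry.angle_zero_right] at h
    exact hθ h.symm
  have h1 := InnerProductGeometry.cos_angle_mul_norm_mul_norm v (S.starProjection v)
  have h2 : inner ℝ v (S.starProjection v) = ‖S.starProjection v‖ * ‖S.starProjection v‖ := by
    rw [← real_inner_self_eq_norm_mul_norm, Submodule.inner_starProjection_left_eq_right,
      Submodule.starProjection_eq_self_iff.2 (Submodule.starProjection_apply_mem _ _)]
  rw [show InnerProductGeometry.angle v (S.starProjection v) = θ from h, h2, ← mul_assoc] at h1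
  exact (mul_right_cancel₀ (norm_ne_zero_iff.2 h0) h1).symm

theorem IsSlantRiemannianMap.inner_phi_self (hJ : IsKaehler J) (hF : IsSlantRiemannianMap E₁ F J θ)
    (hθ : θ ≠ Real.pi / 2) {p : M₁} {w : TangentSpace 𝓘(ℝ, E₂) (F p)}
    (hw : w ∈ rangeAt E₁ E₂ F p) :
    inner ℝ (phi E₁ F J p w) (phi E₁ F J p w) = Real.cos θ ^ 2 * inner ℝ w w := by
  obtain ⟨x, hx, rfl⟩ := exists_horiz_diff_eq F p hw
  by_cases hx0 : x = 0
  · simp [hx0]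
  have h := starProjection_norm_of_angle (hF.angle_eq p x hx hx0) hθ
  rw [← hJ.hermitian (F p) (diff E₁ E₂ F p x), real_inner_self_eq_norm_sq,
    real_inner_self_eq_norm_sq, ← mul_pow, ← h]
  rfl

theorem IsSlantRiemannianMap.inner_phi_phi (hJ : IsKaehler J) (hF : IsSlantRiemannianMap E₁ F J θ)
    (hθ : θ ≠ Real.pi / 2) {p : M₁} {v w : TangentSpace 𝓘(ℝ, E₂) (F p)}
    (hv : v ∈ rangeAt E₁ E₂ F p) (hw : w ∈ rangeAt E₁ E₂ F p) :
    inner ℝ (phi E₁ F J p v) (phi E₁ F J p w) = Real.cos θ ^ 2 * inner ℝ v w := by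
  have h := hF.inner_phi_self hJ hθ (Submodule.add_mem _ hv hw)
  rw [map_add, real_inner_add_add_self, real_inner_add_add_self, hF.inner_phi_self hJ hθ hv,
    hF.inner_phi_self hJ hθ hw] at h
  linarith

theorem IsSlantRiemannianMap.phi_phi (hJ : IsKaehler J) (hF : IsSlantRiemannianMap E₁ F J θ)
    (hθ : θ ≠ Real.pi / 2) {p : M₁} {w : TangentSpace 𝓘(ℝ, E₂) (F p)}
    (hw : w ∈ rangeAt E₁ E₂ F p) :
    phi E₁ F J p (phi E₁ F J p w) = -(Real.cos θ ^ 2 • w) := by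
  refine eq_of_forall_inner_eq (phi_mem_rangeAt p _)
    (Submodule.neg_mem _ (Submodule.smul_mem _ _ hw)) fun c hc => ?_
  rw [inner_phi_left p _ hc, hJ.inner_skew, real_inner_comm, ← inner_phi_left p _
    (phi_mem_rangeAt p w), hF.inner_phi_phi hJ hθ hc hw, inner_neg_left, real_inner_smul_left,
    real_inner_comm]

/-- The slant angle has nonzero cosine, unless the differential vanishes identically. -/
theorem IsSlantRiemannianMap.cos_ne_zero_or (hF : IsSlantRiemannianMap E₁ F J θ)
    (hθ : θ ≠ Real.pi / 2) : Real.cos θ ≠ 0 ∨ ∀ p, diff E₁ E₂ F p = 0 := by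
  by_cases h : ∃ p, ∃ x ∈ horiz E₁ E₂ F p, x ≠ 0
  · obtain ⟨p, x, hx, hx0⟩ := h
    left
    have h := hF.angle_eq p x hx hx0
    rw [angleToSubspace] at h
    intro hcos
    apply hθ
    -- `θ` is now a genuine angle, in `[0, π]`, where the cosine vanishes only at `π / 2`; for an
    -- arbitrary real `θ` this would fail.
    rw [← h] at hcos ⊢
    exact InnerProductGeometry.cos_eq_zero_iff_angle_eq_pi_div_two.1 hcos
  · right
    push Not at h
    intro p
    ext z
    obtain ⟨x, hx, hxz⟩ := exists_horiz_diff_eq F p (w := diff E₁ E₂ F p z) ⟨z, rfl⟩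
    rw [← hxz, h p x hx, map_zero]
    rfl

theorem IsSlantRiemannianMap.slantStructure_sq (hJ : IsKaehler J)
    (hF : IsSlantRiemannianMap E₁ F J θ) (hθ : θ ≠ Real.pi / 2) (hcos : Real.cos θ ≠ 0) {p : M₁}
    {w : TangentSpace 𝓘(ℝ, E₂) (F p)} (hw : w ∈ rangeAt E₁ E₂ F p) :
    slantStructure E₁ F J θ p (slantStructure E₁ F J θ p w) = -w := by
  rw [slantStructure_apply, slantStructure_apply, map_smul, hF.phi_phi hJ hθ hw, smul_neg,
    smul_neg, smul_smul, smul_smul, show (Real.cos θ)⁻¹ * (Real.cos θ)⁻¹ * Real.cos θ ^ 2 = 1 by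
      field_simp, one_smul]

theorem IsRiemannianMap.diff_transport_slantStructure (hF : IsRiemannianMap E₁ E₂ F) {p : M₁}
    (x : TangentSpace 𝓘(ℝ, E₁) p) :
    diff E₁ E₂ F p (transport E₁ F (slantStructure E₁ F J θ) p x) =
      (Real.cos θ)⁻¹ • phi E₁ F J p (diff E₁ E₂ F p x) :=
  hF.diff_adjoint_apply (slantStructure_mem_rangeAt p _)

theorem IsSlantRiemannianMap.isPHWC (hJ : IsKaehler J) (hF : IsSlantRiemannianMap E₁ F J θ)
    (hθ : θ ≠ Real.pi / 2) (hcos : Real.cos θ ≠ 0) :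
    IsPHWC E₁ F (slantStructure E₁ F J θ) where
  invariant p w _ := slantStructure_mem_rangeAt p w
  sq p w hw := hF.slantStructure_sq hJ hθ hcos hw
  hermitian p x hx y hy := by
    rw [← hF.isRiemannianMap.isometric p _ (transport_mem_horiz _ p x) _
      (transport_mem_horiz _ p y), hF.isRiemannianMap.diff_transport_slantStructure,
      hF.isRiemannianMap.diff_transport_slantStructure, real_inner_smul_left, real_inner_smul_right, hF.inner_phi_phi hJ hθ ⟨x, rfl⟩ ⟨y, rfl⟩,
      hF.isRiemannianMap.isometric p x hx y hy]
    field_simp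

theorem IsSlantRiemannianMap.transport_transport (hJ : IsKaehler J)
    (hF : IsSlantRiemannianMap E₁ F J θ) (hθ : θ ≠ Real.pi / 2) (hcos : Real.cos θ ≠ 0) {p : M₁}
    {x : TangentSpace 𝓘(ℝ, E₁) p} (hx : x ∈ horiz E₁ E₂ F p) :
    transport E₁ F (slantStructure E₁ F J θ) p (transport E₁ F (slantStructure E₁ F J θ) p x) =
      -x := by
  change LinearMap.adjoint (diff E₁ E₂ F p) (slantStructure E₁ F J θ p (diff E₁ E₂ F p _)) = -x
  rw [hF.isRiemannianMap.diff_transport_slantStructure, ← slantStructure_apply,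
    hF.slantStructure_sq hJ hθ hcos ⟨x, rfl⟩, map_neg, hF.isRiemannianMap.adjoint_diff_apply hx]

/-! ### Smooth horizontal and vertical fields, and the splitting of the parallelism of `Ĵ`. -/

section Smooth

variable [IsContMDiffRiemannianBundle 𝓘(ℝ, E₁) ∞ E₁ (fun p : M₁ => TangentSpace 𝓘(ℝ, E₁) p)]
  [IsContMDiffRiemannianBundle 𝓘(ℝ, E₂) ∞ E₂ (fun q : M₂ => TangentSpace 𝓘(ℝ, E₂) q)]

omit [FiniteDimensional ℝ E₁] [FiniteDimensional ℝ E₂]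
    [RiemannianBundle (fun p : M₁ => TangentSpace 𝓘(ℝ, E₁) p)]
    [RiemannianBundle (fun q : M₂ => TangentSpace 𝓘(ℝ, E₂) q)] in
theorem contMDiffAt_diff (hF : ContMDiff 𝓘(ℝ, E₁) 𝓘(ℝ, E₂) ∞ F)
    {Y : ∀ p : M₁, TangentSpace 𝓘(ℝ, E₁) p} {p : M₁}
    (hY : ContMDiffAt 𝓘(ℝ, E₁) (𝓘(ℝ, E₁).prod 𝓘(ℝ, E₁)) ∞
      (fun q => (⟨q, Y q⟩ : TangentBundle 𝓘(ℝ, E₁) M₁)) p) :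
    ContMDiffAt 𝓘(ℝ, E₁) (𝓘(ℝ, E₂).prod 𝓘(ℝ, E₂)) ∞
      (fun q => (⟨F q, diff E₁ E₂ F q (Y q)⟩ : TangentBundle 𝓘(ℝ, E₂) M₂)) p :=
  (hF.contMDiff_tangentMap (m := ∞) (by simp)).contMDiffAt.comp p hY

/-- Tested against a smooth `Y`, the field gives `⟪V, F_* Y⟫`, which is visibly smooth. -/
theorem isSmoothField_adjoint (hF : ContMDiff 𝓘(ℝ, E₁) 𝓘(ℝ, E₂) ∞ F)
    {V : ∀ p : M₁, TangentSpace 𝓘(ℝ, E₂) (F p)}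
    (hV : ContMDiff 𝓘(ℝ, E₁) (𝓘(ℝ, E₂).prod 𝓘(ℝ, E₂)) ∞
      (fun q => (⟨F q, V q⟩ : TangentBundle 𝓘(ℝ, E₂) M₂))) :
    IsSmoothField (fun p => LinearMap.adjoint (diff E₁ E₂ F p) (V p)) := by
  refine isSmoothField_of_inner fun p Y hY => ?_
  simp only [LinearMap.adjoint_inner_left]
  exact ContMDiffAt.inner_bundle (F := E₂) (E := fun q : M₂ => TangentSpace 𝓘(ℝ, E₂) q)
    (b := F) hV.contMDiffAt (contMDiffAt_diff hF hY)

theorem isHorizontalField_transport_slantStructure (hJ : IsKaehler J)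
    (hF : ContMDiff 𝓘(ℝ, E₁) 𝓘(ℝ, E₂) ∞ F) {Y : ∀ p : M₁, TangentSpace 𝓘(ℝ, E₁) p}
    (hY : IsSmoothField Y) :
    IsHorizontalField E₂ F (fun p => transport E₁ F (slantStructure E₁ F J θ) p (Y p)) := by
  refine ⟨?_, fun p => transport_mem_horiz _ p _⟩
  have h : (fun p => transport E₁ F (slantStructure E₁ F J θ) p (Y p)) = fun p =>
      (Real.cos θ)⁻¹ • LinearMap.adjoint (diff E₁ E₂ F p) (J (F p) (diff E₁ E₂ F p (Y p))) := by
    funext p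
    change LinearMap.adjoint (diff E₁ E₂ F p) ((Real.cos θ)⁻¹ • phi E₁ F J p _) = _
    rw [map_smul, adjoint_phi]
  rw [h]
  refine ContMDiff.const_smul_section (V := fun p : M₁ => TangentSpace 𝓘(ℝ, E₁) p)
    (isSmoothField_adjoint hF fun p => ?_)
  exact ContMDiffAt.clm_bundle_apply (F₁ := E₂) (F₂ := E₂)
    (E₁ := fun q : M₂ => TangentSpace 𝓘(ℝ, E₂) q) (E₂ := fun q : M₂ => TangentSpace 𝓘(ℝ, E₂) q)
    (b := F) (hJ.smooth.contMDiffAt.comp p hF.contMDiffAt) (contMDiffAt_diff hF (hY p))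

/-- For a Riemannian map `*F_* F_*` is the horizontal projection, and it preserves smoothness; apply
it to any extension of `x`. -/
theorem IsRiemannianMap.exists_isHorizontalField_eq [T2Space M₁] (hF : IsRiemannianMap E₁ E₂ F)
    {p : M₁} {x : TangentSpace 𝓘(ℝ, E₁) p} (hx : x ∈ horiz E₁ E₂ F p) :
    ∃ X : ∀ q : M₁, TangentSpace 𝓘(ℝ, E₁) q, IsHorizontalField E₂ F X ∧ X p = x := by
  obtain ⟨X, hX, rfl⟩ := exists_isSmoothField_eq p x
  exact ⟨_, ⟨isSmoothField_adjoint hF.smooth fun q => contMDiffAt_diff hF.smooth (hX q),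
    fun q => adjoint_diff_mem_horiz F q _⟩, hF.adjoint_diff_apply hx⟩

theorem IsRiemannianMap.exists_isVerticalField_eq [T2Space M₁] (hF : IsRiemannianMap E₁ E₂ F)
    {p : M₁} {u : TangentSpace 𝓘(ℝ, E₁) p} (hu : u ∈ vert E₁ E₂ F p) :
    ∃ U : ∀ q : M₁, TangentSpace 𝓘(ℝ, E₁) q, IsVerticalField E₂ F U ∧ U p = u := by
  obtain ⟨X, hX, rfl⟩ := exists_isSmoothField_eq p u
  have hP : IsSmoothField fun q => LinearMap.adjoint (diff E₁ E₂ F q) (diff E₁ E₂ F q (X q)) :=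
    isSmoothField_adjoint hF.smooth fun q => contMDiffAt_diff hF.smooth (hX q)
  refine ⟨fun q => X q - LinearMap.adjoint (diff E₁ E₂ F q) (diff E₁ E₂ F q (X q)), ⟨?_, ?_⟩, ?_⟩
  · exact ContMDiff.sub_section (V := fun p : M₁ => TangentSpace 𝓘(ℝ, E₁) p) hX hP
  · intro q
    change diff E₁ E₂ F q _ = 0
    rw [map_sub, hF.diff_adjoint_apply ⟨X q, rfl⟩, sub_self]
  · change X p - LinearMap.adjoint _ _ = X p
    rw [show diff E₁ E₂ F p (X p) = 0 from hu, map_zero, sub_zero]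

omit [IsContMDiffRiemannianBundle 𝓘(ℝ, E₂) ∞ E₂ (fun q : M₂ => TangentSpace 𝓘(ℝ, E₂) q)] in
theorem inner_leviCivita_vertical_horizontal {U Z : ∀ p : M₁, TangentSpace 𝓘(ℝ, E₁) p}
    (hU : IsVerticalField E₂ F U) (hZ : IsHorizontalField E₂ F Z) (p : M₁)
    (v : TangentSpace 𝓘(ℝ, E₁) p) :
    inner ℝ (leviCivita U p v) (Z p) = -inner ℝ (U p) (leviCivita Z p v) := by
  have h := mvfderiv_inner ((hU.1 p).mdifferentiableAt (by simp))
    ((hZ.1 p).mdifferentiableAt (by simp)) v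
  have h0 : (fun q => inner ℝ (U q) (Z q)) = fun _ => (0 : ℝ) :=
    funext fun q => Submodule.inner_right_of_mem_orthogonal (hU.2 q) (hZ.2 q)
  rw [h0, mvfderiv_const] at h
  have h' : (0 : ℝ) = _ := h
  linarith

omit [IsContMDiffRiemannianBundle 𝓘(ℝ, E₁) ∞ E₁ (fun p : M₁ => TangentSpace 𝓘(ℝ, E₁) p)] in
theorem secondFF_vertical {X U : ∀ p : M₁, TangentSpace 𝓘(ℝ, E₁) p}
    (hU : IsVerticalField E₂ F U) (p : M₁) :
    secondFF E₂ F X U p = -diff E₁ E₂ F p (leviCivita U p (X p)) := by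
  have h0 : (fun x => diff E₁ E₂ F x (U x)) = fun _ => 0 := funext fun x => hU.2 x
  rw [secondFF, h0, pullbackCov, christoffel_zero_right]
  simp only [map_zero, mvfderiv_const]
  simp

/-- The left side says that `∇_X U` is vertical. Since `⟪∇_X U, Z⟫ = -⟪U, ∇_X Z⟫`, and vertical and
horizontal fields take all vertical and horizontal values at `p`, the two conditions are dual. -/
theorem leviCivita_mem_horiz_iff [T2Space M₁] (hF : IsRiemannianMap E₁ E₂ F)
    {X : ∀ p : M₁, TangentSpace 𝓘(ℝ, E₁) p} {p : M₁} :
    (∀ U : (∀ p : M₁, TangentSpace 𝓘(ℝ, E₁) p), IsVerticalField E₂ F U →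
        secondFF E₂ F X U p = 0) ↔
      ∀ Z : (∀ p : M₁, TangentSpace 𝓘(ℝ, E₁) p), IsHorizontalField E₂ F Z →
        leviCivita Z p (X p) ∈ horiz E₁ E₂ F p := by
  constructor
  · intro h Z hZ
    rw [horiz, Submodule.mem_orthogonal]
    intro u hu
    obtain ⟨U, hU, rfl⟩ := hF.exists_isVerticalField_eq hu
    have h1 := h U hU
    rw [secondFF_vertical hU, neg_eq_zero] at h1
    have h2 := inner_leviCivita_vertical_horizontal hU hZ p (X p)
    rw [Submodule.inner_right_of_mem_orthogonal (K := vert E₁ E₂ F p) h1 (hZ.2 p)] at h2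
    linarith
  · intro h U hU
    rw [secondFF_vertical hU, neg_eq_zero]
    change _ ∈ vert E₁ E₂ F p
    rw [← (vert E₁ E₂ F p).orthogonal_orthogonal, Submodule.mem_orthogonal']
    intro z hz
    obtain ⟨Z, hZ, rfl⟩ := hF.exists_isHorizontalField_eq hz
    rw [inner_leviCivita_vertical_horizontal hU hZ,
      Submodule.inner_right_of_mem_orthogonal (hU.2 p) (h Z hZ), neg_zero]

theorem IsHorizontalField.smul {Y : ∀ p : M₁, TangentSpace 𝓘(ℝ, E₁) p}
    (hY : IsHorizontalField E₂ F Y) (c : ℝ) : IsHorizontalField E₂ F (fun p => c • Y p) :=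
  ⟨ContMDiff.const_smul_section (V := fun p : M₁ => TangentSpace 𝓘(ℝ, E₁) p) hY.1,
    fun p => Submodule.smul_mem _ _ (hY.2 p)⟩

/-- When `cos θ ≠ 0`, homothety splits into the parallelism of `φ` and the condition that the
connection preserves horizontality. -/
theorem IsSlantRiemannianMap.isPseudoHorizontallyHomothetic_iff
    (hJ : IsKaehler J) (hF : IsSlantRiemannianMap E₁ F J θ) (hθ : θ ≠ Real.pi / 2)
    (hcos : Real.cos θ ≠ 0) :
    IsPseudoHorizontallyHomothetic E₁ F (slantStructure E₁ F J θ) ↔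
      (PhiParallel E₁ F J ∧ ∀ X Z : (∀ p : M₁, TangentSpace 𝓘(ℝ, E₁) p),
        IsHorizontalField E₂ F X → IsHorizontalField E₂ F Z →
          ∀ p, leviCivita Z p (X p) ∈ horiz E₁ E₂ F p) := by
  have hR := hF.isRiemannianMap
  have hd : ∀ {Y : ∀ p : M₁, TangentSpace 𝓘(ℝ, E₁) p} (p : M₁), IsSmoothField Y →
      MDifferentiableAt 𝓘(ℝ, E₁) (𝓘(ℝ, E₁).prod 𝓘(ℝ, E₁))
        (fun q => (⟨q, Y q⟩ : TangentBundle 𝓘(ℝ, E₁) M₁)) p :=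
    fun p hY => (hY p).mdifferentiableAt (by simp)
  constructor
  · rintro ⟨-, hpar⟩
    refine ⟨fun X Y Y' hX hY hY' h p => ?_, fun X Z hX hZ p => ?_⟩
    · have h1 := hpar X Y hX hY p
      have h2 : (fun q => transport E₁ F (slantStructure E₁ F J θ) q (Y q)) =
          fun q => (Real.cos θ)⁻¹ • Y' q := by
        funext q
        change LinearMap.adjoint (diff E₁ E₂ F q) ((Real.cos θ)⁻¹ • phi E₁ F J q _) = _
        rw [h, map_smul, hR.adjoint_diff_apply (hY'.2 q)]
      rw [h2, leviCivita_smul _ (hd p hY'.1)] at h1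
      have h3 := congrArg (diff E₁ E₂ F p) h1
      rw [map_sub, map_smul, hR.diff_transport_slantStructure, ← smul_sub, map_zero] at h3
      exact (smul_eq_zero.1 h3).resolve_left (inv_ne_zero hcos)
    -- Parallelism applied to `ĴZ`, with `Ĵ² = -1`, gives `-∇_X Z = Ĵ(∇_X(ĴZ))`, which is
    -- horizontal.
    · have hY := isHorizontalField_transport_slantStructure (θ := θ) hJ hR.smooth hZ.1
      have h1 := sub_eq_zero.1 (hpar X _ hX hY p)
      have h2 : (fun q => transport E₁ F (slantStructure E₁ F J θ) q
          (transport E₁ F (slantStructure E₁ F J θ) q (Z q))) = fun q => (-1 : ℝ) • Z q := by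
        funext q
        rw [hF.transport_transport hJ hθ hcos (hZ.2 q), neg_one_smul]
      rw [h2, leviCivita_smul _ (hd p hZ.1), neg_one_smul] at h1
      rw [← neg_mem_iff, h1]
      exact transport_mem_horiz _ p _
  · rintro ⟨hphi, hhor⟩
    refine ⟨hF.isPHWC hJ hθ hcos, fun X Y hX hY p => ?_⟩
    have hJY := isHorizontalField_transport_slantStructure (θ := θ) hJ hR.smooth hY.1
    -- The partner of `Y` is `Y' = cos θ · ĴY`, since `F_* Ĵ = sec θ φ F_*`.
    have h1 := hphi X Y _ hX hY (hJY.smul (Real.cos θ)) (fun q => by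
      rw [map_smul, hR.diff_transport_slantStructure, smul_inv_smul₀ hcos]) p
    rw [leviCivita_smul _ (hd p hJY.1), map_smul, sub_eq_zero, ← eq_inv_smul_iff₀ hcos] at h1
    -- The difference `∇_X(ĴY) - Ĵ(∇_X Y)` is horizontal, so it is recovered from its image under
    -- `F_*`, which `h1` shows to be zero.
    have hmem := Submodule.sub_mem _ (hhor X _ hX hJY p)
      (transport_mem_horiz (slantStructure E₁ F J θ) p (leviCivita Y p (X p)))
    rw [← hR.adjoint_diff_apply hmem, map_sub, hR.diff_transport_slantStructure, h1, sub_self,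
      map_zero]

end Smooth

/-! ### The degenerate case of vanishing differential. -/

theorem leviCivita_zero
    [IsContMDiffRiemannianBundle 𝓘(ℝ, E₁) ∞ E₁ (fun p : M₁ => TangentSpace 𝓘(ℝ, E₁) p)] (p : M₁)
    (v : TangentSpace 𝓘(ℝ, E₁) p) : leviCivita (fun _ => 0) p v = 0 := by
  rw [leviCivita_eq, christoffel_zero_right]
  simp only [map_zero, mvfderiv_const]
  simp

/-- Here `range F_*` and the horizontal spaces are zero, so every condition concerns zero vectors,
whatever `K` is. -/
theorem isPseudoHorizontallyHomothetic_of_diff_eq_zero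
    [IsContMDiffRiemannianBundle 𝓘(ℝ, E₁) ∞ E₁ (fun p : M₁ => TangentSpace 𝓘(ℝ, E₁) p)]
    (h : ∀ p, diff E₁ E₂ F p = 0)
    (K : ∀ p : M₁, TangentSpace 𝓘(ℝ, E₂) (F p) →ₗ[ℝ] TangentSpace 𝓘(ℝ, E₂) (F p)) :
    IsPseudoHorizontallyHomothetic E₁ F K := by
  have hw : ∀ p, ∀ w ∈ rangeAt E₁ E₂ F p, w = 0 := by
    rintro p _ ⟨x, rfl⟩
    rw [h]; rfl
  have hx : ∀ p, ∀ x ∈ horiz E₁ E₂ F p, x = 0 := by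
    intro p x hx
    refine inner_self_eq_zero.1 (Submodule.inner_right_of_mem_orthogonal
      (K := vert E₁ E₂ F p) (u := x) (v := x) ?_ hx)
    change diff E₁ E₂ F p x = 0
    rw [h]; rfl
  refine ⟨⟨fun p w hp => ?_, fun p w hp => ?_, fun p x hp y _ => ?_⟩, fun X Y _ _ p => ?_⟩
  · rw [hw p w hp, map_zero]; exact Submodule.zero_mem _
  · rw [hw p w hp]; simp
  · rw [hx p x hp]; simp
  · have hT : ∀ p x, transport E₁ F K p x = 0 := fun p x => hx p _ (transport_mem_horiz K p x)
    simp only [hT, leviCivita_zero, sub_zero]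

theorem phiParallel_of_diff_eq_zero (h : ∀ p, diff E₁ E₂ F p = 0) : PhiParallel E₁ F J := by
  intro X Y Y' _ _ _ _ p
  simp [h]

end Maps

end SlantMap

open SlantMap in
theorem theorem4p1
    {E₁ : Type*} [NormedAddCommGroup E₁] [NormedSpace ℝ E₁] [FiniteDimensional ℝ E₁]
    {M₁ : Type*} [TopologicalSpace M₁] [T2Space M₁] [ChartedSpace E₁ M₁]
    [IsManifold 𝓘(ℝ, E₁) ∞ M₁]
    [RiemannianBundle (fun p : M₁ => TangentSpace 𝓘(ℝ, E₁) p)]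
    [IsContMDiffRiemannianBundle 𝓘(ℝ, E₁) ∞ E₁ (fun p : M₁ => TangentSpace 𝓘(ℝ, E₁) p)]
    {E₂ : Type*} [NormedAddCommGroup E₂] [NormedSpace ℝ E₂] [FiniteDimensional ℝ E₂]
    {M₂ : Type*} [TopologicalSpace M₂] [T2Space M₂] [ChartedSpace E₂ M₂]
    [IsManifold 𝓘(ℝ, E₂) ∞ M₂]
    [RiemannianBundle (fun q : M₂ => TangentSpace 𝓘(ℝ, E₂) q)]
    [IsContMDiffRiemannianBundle 𝓘(ℝ, E₂) ∞ E₂ (fun q : M₂ => TangentSpace 𝓘(ℝ, E₂) q)]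
    (J : ∀ q : M₂, TangentSpace 𝓘(ℝ, E₂) q →L[ℝ] TangentSpace 𝓘(ℝ, E₂) q)
    (hJ : IsKaehler J)
    (F : M₁ → M₂) (θ : ℝ) (hF : IsSlantRiemannianMap E₁ F J θ) (hθ : θ ≠ Real.pi / 2) :
    IsPseudoHorizontallyHomothetic E₁ F (slantStructure E₁ F J θ) ↔
      (PhiParallel E₁ F J ∧
        ∀ X U : (∀ p : M₁, TangentSpace 𝓘(ℝ, E₁) p),
          IsHorizontalField E₂ F X → IsVerticalField E₂ F U → ∀ p, secondFF E₂ F X U p = 0) := by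
  rcases hF.cos_ne_zero_or hθ with hcos | h
  · rw [hF.isPseudoHorizontallyHomothetic_iff hJ hθ hcos]
    refine and_congr_right fun _ => ⟨fun h X U hX hU p => ?_, fun h X Z hX hZ p => ?_⟩
    · exact (leviCivita_mem_horiz_iff hF.isRiemannianMap).2 (fun Z hZ => h X Z hX hZ p) U hU
    · exact (leviCivita_mem_horiz_iff hF.isRiemannianMap).1 (fun U hU => h X U hX hU p) Z hZ
  · refine iff_of_true (isPseudoHorizontallyHomothetic_of_diff_eq_zero h _)
      ⟨phiParallel_of_diff_eq_zero h, fun X U _ hU p => ?_⟩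
    rw [secondFF_vertical hU, h]
    simp
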